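/- **Conventions.** A *graph* has a finite vertex set $V$ and a finite edge set $E$ (loops and multiple edges allowed). Each edge has two ends, each connected to one vertex or to none, and at least one of them connected to a vertex; an edge with exactly one end connected to a vertex is an *outer-edge*; a *loop* has both ends at the same vertex, a *link* at two distinct vertices. A *signed graph* $\Sigma$ is a graph with a sign function $\sigma:E\to\{-1,1\}$. A *circle* is a connected 2-regular subgraph without outer-edges (a loop contributes 2 to the degree), and its sign is the product of its edge signs. A signed graph is *balanced* if it has no outer-edges and all its circles are positive; otherwise it is *unbalanced*. An *orientation* of an edge $e$ puts an arrow on each of its two ends, the two arrows pointing in the same direction along $e$ iff $e$ is positive; each edge has two orientations, opposite to each other. An *arc* is an oriented edge. The incidence number $[v,\vec e\,]\in\mathbb Z$ is the sum over the ends of $e$ connected to $v$ of $+1$ if the arrow there points to $v$ and $-1$ if it points away from $v$. For $R=\mathbb Z$ or $\mathbb R$, a *1-chain* over $R$ is a function $c$ on arcs with values in $R$ and $c(\vec e^{\,-1})=-c(\vec e\,)$; its *support* is $\{e: c(\vec e\,)\ne0\}$. A *flow* is a 1-chain $f$ with $\sum_{e}[v,\vec e\,]f(\vec e\,)=0$ for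 all $v\in V$. A *tension* is a 1-chain $g$ with $\sum_e f(\vec e\,)g(\vec e\,)=0$ for all integer-valued flows $f$. A nonzero flow or tension over $R$ is *elementary* if its support is minimal under inclusion among the supports of the nonzero flows, respectively tensions, over $R$. The *frame matroid* $\mathcal M(\Sigma)$ is the matroid on $E$ whose circuits are the supports of the elementary real flows. For nonempty $X\subseteq V$ let $\Sigma[X]$ be the subgraph on $X$ with all loops and links whose endpoints lie in $X$. Let $\nu:V\to\{-1,1\}$ with $\nu=1$ off $X$ (a *switching on $X$*). Let $\Sigma^\nu$ be $\Sigma$ with the sign of each edge multiplied by $\nu(u)\nu(v)$ if it is a loop or link $uv$, and by $\nu(u)$ if it is an outer-edge at $u$. Let $\delta X^\nu$ consist of the links between $X$ and $V\setminus X$, the edges of $\Sigma[X]$ that are negative in $\Sigma^\nu$, and the outer-edges with endpoint in $X$. A *cut* is a nonempty edge set $U=\delta X^\nu$ of this form such that $\Sigma[X]\setminus U$ is balanced (its edges being positive in $\Sigma^\nu$, and the edges of $\Sigma[X]$ in $U$ negative in $\Sigma^\nu$) and $(\Sigma[X]\setminus U)\cup e$ is unbalanced for each edge $e\in U$ of $\Sigma[X]$.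 A *bond* is a cut that properly contains no cut. **Theorem (Characterization of elementary tensions).** Let $\Sigma$ be a connected unbalanced signed graph and let $U\subseteq E$. Then $U$ is a bond of $\Sigma$ if and only if $U$ is the support of an elementary integer-valued tension of $\Sigma$. (This holds both when "elementary" is understood among integer-valued tensions and when it is understood among real-valued tensions.) Moreover, $U$ is a bond of $\Sigma$ if and only if $U$ is a cocircuit of the frame matroid $\mathcal M(\Sigma)$, that is, a circuit of its dual matroid. -/

import Mathlib

/-- A signed graph with vertices `V` and edges `E`, multiple edges allowed.  Each edge has two ends
(labelled by `Fin 2`), each connected to one vertex or to none (`none`), and at least one of them is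
connected to a vertex.  An edge with an end `none` is an outer-edge; outer-edges carry signs too. -/
structure SignedGraph (V E : Type*) where
  ends : E → Fin 2 → Option V
  attached : ∀ e, ∃ i, ends e i ≠ none
  sign : E → ℤˣ

namespace SignedGraph

variable {V E : Type*} (G : SignedGraph V E)

/-! ### Connectedness and balance -/

/-- `e` is an outer-edge: one of its ends is connected to no vertex. -/
def IsOuter (e : E) : Prop := ∃ i, G.ends e i = none

/-- `u` and `v` are the two endpoints (possibly equal) of some edge of `S`. -/
def Adj (S : Set E) (u v : V) : Prop :=
  ∃ e ∈ S, ∃ i j, i ≠ j ∧ G.ends e i = some u ∧ G.ends e j = some v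

/-- `u` and `v` lie in the same component of the spanning subgraph with edge set `S`. -/
def Joined (S : Set E) : V → V → Prop := Relation.ReflTransGen (G.Adj S)

/-- The signed graph is connected. -/
def IsConnected : Prop := Nonempty V ∧ ∀ u v, G.Joined Set.univ u v

open Classical in
/-- The degree of `v` in the subgraph with edge set `C` (a loop counts twice). -/
noncomputable def degree (C : Finset E) (v : V) : ℕ :=
  ∑ e ∈ C, ∑ i : Fin 2, if G.ends e i = some v then 1 else 0

/-- `C` is the edge set of a circle: a connected 2-regular subgraph without outer-edges. (The
vertices of the subgraph are those of nonzero degree.) -/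
def IsCircle (C : Finset E) : Prop :=
  C.Nonempty ∧ (∀ e ∈ C, ¬ G.IsOuter e) ∧
    (∀ v, G.degree C v ≠ 0 → G.degree C v = 2) ∧
    ∀ u v, G.degree C u ≠ 0 → G.degree C v ≠ 0 → G.Joined (C : Set E) u v

/-- The subgraph with edge set `S` is balanced: it has no outer-edges and all its circles are
positive. -/
def IsBalanced (S : Set E) : Prop :=
  (∀ e ∈ S, ¬ G.IsOuter e) ∧
    ∀ C : Finset E, (C : Set E) ⊆ S → G.IsCircle C → ∏ e ∈ C, G.sign e = 1

/-! ### Switching, cuts and bonds -/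

/-- The signed graph obtained by the switching `ν`: the sign of `e` is multiplied by the values of
`ν` at the (one or two) vertices to which the ends of `e` are connected. -/
def switch (ν : V → ℤˣ) : SignedGraph V E where
  ends := G.ends
  attached := G.attached
  sign e := G.sign e * ∏ i : Fin 2, (G.ends e i).elim 1 ν

/-- The edges of the compact subgraph induced by `X`: loops and links with all endpoints in `X`. -/
def inner (X : Set V) : Set E := {e | ∀ i, ∃ v ∈ X, G.ends e i = some v}

/-- The link edges between `X` and its complement. -/
def crossing (X : Set V) : Set E :=
  {e | ∃ i j, ∃ u ∈ X, ∃ v ∉ X, G.ends e i = some u ∧ G.ends e j = some v}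

/-- The outer-edges with endpoint in `X`. -/
def outer (X : Set V) : Set E := {e | G.IsOuter e ∧ ∃ i, ∃ v ∈ X, G.ends e i = some v}

/-- The edge set `δX^ν`: links between `X` and its complement, edges inside `X` that are negative
after switching by `ν`, and outer-edges at `X`. -/
def cutSet (X : Set V) (ν : V → ℤˣ) : Set E :=
  G.crossing X ∪ {e | e ∈ G.inner X ∧ (G.switch ν).sign e = -1} ∪ G.outer X

/-- A cut of the signed graph. -/
def IsCut (U : Set E) : Prop :=
  U.Nonempty ∧ ∃ (X : Set V) (ν : V → ℤˣ), X.Nonempty ∧ (∀ v ∉ X, ν v = 1) ∧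
    U = G.cutSet X ν ∧
    G.IsBalanced (G.inner X \ U) ∧
    (∀ e ∈ G.inner X ∩ U, (G.switch ν).sign e = -1) ∧
    (∀ e ∈ G.inner X \ U, (G.switch ν).sign e = 1) ∧
    ∀ e ∈ G.inner X ∩ U, ¬ G.IsBalanced (insert e (G.inner X \ U))

/-- A bond: a cut that properly contains no cut. -/
def IsBond (U : Set E) : Prop := G.IsCut U ∧ ∀ U', G.IsCut U' → ¬ U' ⊂ U

/-! ### Arcs, chains, flows and tensions -/

/-- An arc (oriented edge): an edge with an arrow at each of its two ends.  The value `1` means that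
the arrow at that end points to the end, `-1` that it points away from it.  The arrows have the same
direction along the edge (they point to one end and away from the other) iff the edge is
positive. -/
@[ext] structure Arc where
  edge : E
  arrow : Fin 2 → ℤˣ
  compat : arrow 0 * arrow 1 = - G.sign edge

variable {G} in
/-- The opposite arc. -/
def Arc.rev (a : G.Arc) : G.Arc where
  edge := a.edge
  arrow i := - a.arrow i
  compat := by simpa using a.compat

/-- A chosen orientation of each edge.  The notions below do not depend on the choice. -/
def arc (e : E) : G.Arc where
  edge := e
  arrow := ![1, - G.sign e]
  compat := by simp

/-- Each edge has exactly two orientations, opposite to each other. -/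
theorem eq_arc_or_eq_rev (a : G.Arc) : a = G.arc a.edge ∨ a = (G.arc a.edge).rev := by
  obtain ⟨e, f, h⟩ := a
  rcases Int.units_eq_one_or (f 0) with h0 | h0
  · left
    ext i
    · rfl
    · rw [h0] at h
      fin_cases i
      · simp [arc, h0]
      · simp [arc, ← h]
  · right
    ext i
    · rfl
    · rw [h0] at h
      fin_cases i
      · simp [arc, Arc.rev, h0]
      · simp [arc, Arc.rev, ← h]

open Classical in
/-- The incidence number `[v, a]`: `±1` for a non-loop arc pointing to/away from `v`, `±2` for a
negative loop at `v`, and `0` otherwise. -/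
noncomputable def incidence (v : V) (a : G.Arc) : ℤ :=
  ∑ i : Fin 2, if G.ends a.edge i = some v then (a.arrow i : ℤ) else 0

/-- The group of `1`-chains with coefficients in `R`: functions on arcs that change sign when the
arc is reversed. -/
def chains (R : Type*) [CommRing R] : Submodule R (G.Arc → R) where
  carrier := {c | ∀ a, c a.rev = - c a}
  zero_mem' := by simp
  add_mem' := by
    intro c d hc hd a
    simp only [Pi.add_apply, hc a, hd a]
    ring
  smul_mem' := by
    intro r c hc a
    simp [hc a]

/-- The support of a `1`-chain. -/
def support {G : SignedGraph V E} {R : Type*} [CommRing R] (c : G.chains R) : Set E :=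
  {e | c.1 (G.arc e) ≠ 0}

variable {G} in
theorem chain_ext {R : Type*} [CommRing R] {c : G.chains R} (h : ∀ e, c.1 (G.arc e) = 0) :
    c = 0 := by
  ext a
  rcases G.eq_arc_or_eq_rev a with ha | ha
  · rw [ha, h]
    rfl
  · rw [ha, c.2, h]
    simp

variable {G} in
theorem support_eq_empty {c : G.chains ℝ} (h : support c = ∅) : c = 0 :=
  chain_ext fun e => by
    by_contra he
    exact Set.notMem_empty e (h ▸ he)

section Fintype

variable [Fintype E]

/-- The boundary operator `(∂c)(v) = ∑ₑ [v, e] c(e)`. -/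
noncomputable def boundary (R : Type*) [CommRing R] : G.chains R →ₗ[R] (V → R) where
  toFun c v := ∑ e, (G.incidence v (G.arc e) : R) * c.1 (G.arc e)
  map_add' c d := by
    ext v
    simp [mul_add, Finset.sum_add_distrib]
  map_smul' r c := by
    ext v
    simp only [Submodule.coe_smul, Pi.smul_apply, smul_eq_mul, RingHom.id_apply, Finset.mul_sum]
    exact Finset.sum_congr rfl fun e _ => by ring

/-- The flow group. -/
noncomputable def flows (R : Type*) [CommRing R] : Submodule R (G.chains R) :=
  LinearMap.ker (G.boundary R)

/-- The pairing of an integer-valued `1`-chain with a `1`-chain. -/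
def pairing {G : SignedGraph V E} {R : Type*} [CommRing R] (c : G.chains ℤ) (d : G.chains R) : R :=
  ∑ e, (c.1 (G.arc e) : R) * d.1 (G.arc e)

/-- The tension group: the `1`-chains orthogonal to all integer-valued flows. -/
def tensions (R : Type*) [CommRing R] : Submodule R (G.chains R) where
  carrier := {g | ∀ f ∈ G.flows ℤ, pairing f g = 0}
  zero_mem' := by
    intro f _
    simp [pairing]
  add_mem' := by
    intro c d hc hd f hf
    have h1 := hc f hf
    have h2 := hd f hf
    simp only [pairing] at h1 h2 ⊢
    simp [mul_add, Finset.sum_add_distrib, h1, h2]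
  smul_mem' := by
    intro r c hc f hf
    have h1 := hc f hf
    simp only [pairing] at h1 ⊢
    simp only [Submodule.coe_smul, Pi.smul_apply, smul_eq_mul]
    rw [← mul_zero r, ← h1, Finset.mul_sum]
    exact Finset.sum_congr rfl fun e _ => by ring

end Fintype

/-- A nonzero chain of `W` is elementary if its support is minimal among the supports of the nonzero
chains of `W`. -/
def IsElementary {G : SignedGraph V E} {R : Type*} [CommRing R] (W : Submodule R (G.chains R))
    (c : G.chains R) : Prop :=
  c ∈ W ∧ c ≠ 0 ∧ ∀ c' ∈ W, c' ≠ 0 → support c' ⊆ support c → support c' = support c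

/-! ### The frame matroid -/

section Matroid

variable {G} [Fintype E] (W : Submodule ℝ (G.chains ℝ))

theorem exists_elementary {c : G.chains ℝ} (hc : c ∈ W) (h0 : c ≠ 0) :
    ∃ d, IsElementary W d ∧ support d ⊆ support c := by
  obtain ⟨S, hSc, hS⟩ := Set.Finite.exists_le_minimal
    (s := {S : Set E | ∃ d ∈ W, d ≠ 0 ∧ support d = S}) (Set.toFinite _)
    (a := support c) ⟨c, hc, h0, rfl⟩
  obtain ⟨d, hd, hd0, rfl⟩ := hS.prop
  exact ⟨d, ⟨hd, hd0, fun c' hc' h0' hsub =>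
    Set.Subset.antisymm hsub (hS.le_of_le ⟨c', hc', h0', rfl⟩ hsub)⟩, hSc⟩

theorem no_elementary_iff (I : Set E) :
    (∀ c, IsElementary W c → ¬ support c ⊆ I) ↔ ∀ c ∈ W, support c ⊆ I → c = 0 := by
  constructor
  · intro h c hc hI
    by_contra h0
    obtain ⟨d, hd, hdc⟩ := exists_elementary W hc h0
    exact h d hd (hdc.trans hI)
  · intro h c hc hI
    exact hc.2.1 (h c hc.1 hI)

theorem augment {I J : Set E} (hI : ∀ c ∈ W, support c ⊆ I → c = 0)
    (hJ : ∀ c ∈ W, support c ⊆ J → c = 0) (hIJ : I.ncard < J.ncard) :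
    ∃ e ∈ J, e ∉ I ∧ ∀ c ∈ W, support c ⊆ insert e I → c = 0 := by
  classical
  by_contra hcon
  push Not at hcon
  have hex : ∀ e : ↥(J \ I), ∃ c ∈ W, support c ⊆ insert e.1 I ∧ c ≠ 0 := fun e =>
    hcon e.1 e.2.1 e.2.2
  choose c hcW hcs hc0 using hex
  have hdiag : ∀ e, (c e).1 (G.arc e.1) ≠ 0 := by
    intro e he
    refine hc0 e (hI _ (hcW e) fun x hx => ?_)
    rcases hcs e hx with rfl | hxI
    · exact absurd he hx
    · exact hxI
  have hoff : ∀ e e' : ↥(J \ I), e ≠ e' → (c e).1 (G.arc e'.1) = 0 := by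
    intro e e' hne
    by_contra hx
    rcases hcs e hx with h | h
    · exact hne (Subtype.ext h.symm)
    · exact e'.2.2 h
  let T : (↥(J \ I) → ℝ) →ₗ[ℝ] (↥(I \ J) → ℝ) :=
    { toFun := fun a x => ∑ e, a e * (c e).1 (G.arc x.1)
      map_add' := fun a b => by
        ext x
        simp [add_mul, Finset.sum_add_distrib]
      map_smul' := fun r a => by
        ext x
        simp [Finset.mul_sum, mul_assoc] }
  have hcard : Module.finrank ℝ (↥(I \ J) → ℝ) < Module.finrank ℝ (↥(J \ I) → ℝ) := by
    rw [Module.finrank_fintype_fun_eq_card, Module.finrank_fintype_fun_eq_card,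
      ← Nat.card_eq_fintype_card, ← Nat.card_eq_fintype_card, Nat.card_coe_set_eq,
      Nat.card_coe_set_eq]
    exact (Set.ncard_lt_ncard_iff_ncard_sdiff_lt_ncard_sdiff (Set.toFinite I) (Set.toFinite J)).1 hIJ
  obtain ⟨a, haT, ha0⟩ := (Submodule.ne_bot_iff _).1 (LinearMap.ker_ne_bot_of_finrank_lt (f := T) hcard)
  have heval : ∀ x : E, (∑ e, a e • c e : G.chains ℝ).1 (G.arc x) =
      ∑ e, a e * (c e).1 (G.arc x) := by
    intro x
    simp [Finset.sum_apply]
  have hzero : (∑ e, a e • c e : G.chains ℝ) = 0 := by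
    refine hJ _ (Submodule.sum_mem _ fun e _ => Submodule.smul_mem _ _ (hcW e)) fun x hx => ?_
    by_contra hxJ
    apply hx
    rw [heval]
    by_cases hxI : x ∈ I
    · exact congrFun (LinearMap.mem_ker.1 haT) ⟨x, hxI, hxJ⟩
    · refine Finset.sum_eq_zero fun e _ => ?_
      have : (c e).1 (G.arc x) = 0 := by
        by_contra hne
        rcases hcs e hne with h | h
        · exact hxJ (h ▸ e.2.1)
        · exact hxI h
      rw [this, mul_zero]
  apply ha0
  ext e
  have h1 := heval e.1
  rw [hzero, Finset.sum_eq_single e (fun e' _ hne => by rw [hoff e' e hne, mul_zero])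
    (fun h => absurd (Finset.mem_univ e) h)] at h1
  have h2 : a e * (c e).1 (G.arc e.1) = 0 := h1.symm
  simpa using (mul_eq_zero.1 h2).resolve_right (hdiag e)

/-- The matroid of a space `W` of real `1`-chains: its circuits are the supports of the elementary
chains of `W`, so a set is independent iff it contains no such support. -/
noncomputable def chainMatroid : Matroid E :=
  (IndepMatroid.ofFinite (E := Set.univ) Set.finite_univ
    (fun I => ∀ c, IsElementary W c → ¬ support c ⊆ I)
    (fun c hc h => hc.2.1 (support_eq_empty (Set.subset_empty_iff.1 h)))
    (fun _ _ hJ hIJ c hc h => hJ c hc (h.trans hIJ))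
    (fun I J hI hJ hIJ => by
      simp only [no_elementary_iff] at hI hJ ⊢
      exact augment W hI hJ hIJ)
    (fun I _ => Set.subset_univ I)).matroid

/-- The circuits of the matroid of `W` are exactly the supports of elementary chains of `W`. -/
theorem chainMatroid_isCircuit_iff (C : Set E) :
    (chainMatroid W).IsCircuit C ↔ ∃ c, IsElementary W c ∧ support c = C := by
  have hind : ∀ I, (chainMatroid W).Indep I ↔ ∀ c, IsElementary W c → ¬ support c ⊆ I :=
    fun I => Iff.rfl
  rw [Matroid.isCircuit_iff_minimal_not_indep (M := chainMatroid W) (Set.subset_univ C)]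
  simp only [hind]
  push Not
  constructor
  · intro h
    obtain ⟨c, hc, hcC⟩ := h.prop
    exact ⟨c, hc, Set.Subset.antisymm hcC (h.le_of_le ⟨c, hc, Set.Subset.rfl⟩ hcC)⟩
  · rintro ⟨c, hc, rfl⟩
    refine ⟨⟨c, hc, Set.Subset.rfl⟩, ?_⟩
    rintro S ⟨d, hd, hdS⟩ hSc
    rw [← hc.2.2 d hd.1 hd.2.1 (hdS.trans hSc)]
    exact hdS

variable (G) in
/-- The frame matroid of the signed graph: its circuits are the minimal nonempty edge sets that
support a nowhere-zero real flow. -/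
noncomputable def frameMatroid : Matroid E := chainMatroid (G.flows ℝ)

end Matroid

end SignedGraph

/-! Real tensions are exactly the coboundaries of vertex potentials `p`, with an unattached end
counted as potential 0. An edge `uv` of sign `σ` has zero drop iff `p u = σ * p v`. If `p` is a
switching function `ν` on `X` and 0 elsewhere, the drop is therefore nonzero exactly on `δX^ν`, so
every cut supports an integer tension (`support_potentialDrop_eq_cutSet`).

Conversely, the support of a nonzero coboundary contains a cut (`exists_isCut_subset`). Let `X` be
the component of a vertex with `p ≠ 0` under the zero-drop edges. Along such edges `|p|` is
constant, so on `X` the potential is a positive multiple of a sign function `ν`, and `δX^ν` lies in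
the support. It is nonempty because the graph is connected and unbalanced. Putting back an edge of
`δX^ν` inside `X` closes a circle with exactly one negative edge after switching.

Thus cuts and supports of nonzero tensions have the same minimal members
(`Set.minimal_iff_of_cofinal`). The matroid statement follows the same pattern: the dependent sets
of the dual are those containing the support of a nonzero coboundary (`frameMatroid_dual_dep_iff`),
by orthogonality of flows and coboundaries. -/

namespace SignedGraph

variable {V E : Type*}

/-! ### Balance and switching -/

section Balance

variable (G : SignedGraph V E)

/-- Switching contributes `ν v` once for each edge end at `v`, that is `ν v ^ degree` in total, and
all degrees in a circle are 0 or 2. -/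
theorem IsCircle.prod_switch_sign [Fintype V] {C : Finset E} (hC : G.IsCircle C) (ν : V → ℤˣ) :
    ∏ e ∈ C, (G.switch ν).sign e = ∏ e ∈ C, G.sign e := by
  classical
  have h1 : ∀ e i, (G.ends e i).elim 1 ν =
      ∏ v, ν v ^ (if G.ends e i = some v then 1 else 0) := by
    intro e i
    cases h : G.ends e i with
    | none => simp
    | some w =>
      rw [Finset.prod_eq_single w]
      · simp
      · intro b _ hb
        simp [hb.symm]
      · simp
  have h2 : ∏ e ∈ C, ∏ i : Fin 2, (G.ends e i).elim 1 ν = 1 := by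
    have h3 : ∏ e ∈ C, ∏ i : Fin 2, (G.ends e i).elim 1 ν = ∏ v, ν v ^ G.degree C v := by
      simp only [h1, degree]
      rw [Finset.prod_congr rfl fun e _ => Finset.prod_comm, Finset.prod_comm]
      refine Finset.prod_congr rfl fun v _ => ?_
      rw [← Finset.prod_pow_eq_pow_sum]
      refine Finset.prod_congr rfl fun e _ => ?_
      rw [← Finset.prod_pow_eq_pow_sum]
    rw [h3]
    refine Finset.prod_eq_one fun v _ => ?_
    by_cases h : G.degree C v = 0
    · rw [h, pow_zero]
    · rw [hC.2.2.1 v h, Int.units_sq]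
  simp only [switch, Finset.prod_mul_distrib] at h2 ⊢
  rw [h2, mul_one]

theorem isBalanced_of_switch_sign [Fintype V] {S : Set E} {ν : V → ℤˣ}
    (ho : ∀ e ∈ S, ¬ G.IsOuter e) (hs : ∀ e ∈ S, (G.switch ν).sign e = 1) : G.IsBalanced S := by
  refine ⟨ho, fun C hCS hC => ?_⟩
  rw [← hC.prod_switch_sign G ν]
  exact Finset.prod_eq_one fun e he => hs e (hCS he)

/-! ### Joined vertices, paths and circles -/

theorem Adj.symm {S : Set E} {u v : V} (h : G.Adj S u v) : G.Adj S v u := by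
  obtain ⟨e, he, i, j, hij, hi, hj⟩ := h
  exact ⟨e, he, j, i, hij.symm, hj, hi⟩

theorem Adj.mono {S T : Set E} (hST : S ⊆ T) {u v : V} (h : G.Adj S u v) : G.Adj T u v := by
  obtain ⟨e, he, h⟩ := h
  exact ⟨e, hST he, h⟩

theorem Joined.mono {S T : Set E} (hST : S ⊆ T) {u v : V} (h : G.Joined S u v) :
    G.Joined T u v :=
  Relation.ReflTransGen.mono (fun _ _ h => Adj.mono G hST h) _ _ h

theorem Joined.symm {S : Set E} {u v : V} (h : G.Joined S u v) : G.Joined S v u :=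
  haveI : Std.Symm (G.Adj S) := ⟨fun _ _ => Adj.symm G⟩
  Relation.ReflTransGen.stdSymm.symm _ _ h

open Classical in
theorem degree_insert {P : Finset E} {e : E} (he : e ∉ P) {i j : Fin 2} (hij : i ≠ j) {u v : V}
    (hi : G.ends e i = some u) (hj : G.ends e j = some v) (x : V) :
    G.degree (insert e P) x = G.degree P x + (if x = u then 1 else 0) + if x = v then 1 else 0 := by
  have h : (∑ k : Fin 2, if G.ends e k = some x then 1 else 0) =
      (if x = u then 1 else 0) + if x = v then 1 else 0 := by
    rw [Fin.sum_univ_two]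
    simp only [eq_comm (a := x)]
    fin_cases i <;> fin_cases j <;> simp_all [add_comm]
  rw [degree, degree, Finset.sum_insert he, h]
  omega

theorem not_isOuter_of_ends {e : E} {i j : Fin 2} (hij : i ≠ j) {u v : V}
    (hi : G.ends e i = some u) (hj : G.ends e j = some v) : ¬ G.IsOuter e := by
  rintro ⟨k, hk⟩
  fin_cases i <;> fin_cases j <;> fin_cases k <;> simp_all

/-- The simple graph of the links in `S`. -/
def linkGraph (S : Set E) : SimpleGraph V where
  Adj u v := u ≠ v ∧ G.Adj S u v
  symm := ⟨fun _ _ h => ⟨h.1.symm, Adj.symm G h.2⟩⟩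
  loopless := ⟨fun _ h => h.1 rfl⟩

theorem Joined.reachable {S : Set E} {u v : V} (h : G.Joined S u v) :
    (G.linkGraph S).Reachable u v := by
  induction h with
  | refl => exact SimpleGraph.Reachable.refl _
  | @tail b c _ hbc ih =>
    by_cases hne : b = c
    · exact hne ▸ ih
    · exact ih.trans (SimpleGraph.Adj.reachable ⟨hne, hbc⟩)

-- The degree equation says that a further edge from `u` to `v` would make the path 2-regular. It
-- also covers `u = v`, where the path is empty and the further edge is a loop.
open Classical in
theorem exists_path_edges {S : Set E} {u v : V} (p : (G.linkGraph S).Walk u v) (hp : p.IsPath) :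
    ∃ P : Finset E, (P : Set E) ⊆ S ∧ (∀ e ∈ P, ¬ G.IsOuter e) ∧
      (∀ x, G.degree P x + (if x = u then 1 else 0) + (if x = v then 1 else 0) =
        if x ∈ p.support then 2 else 0) ∧
      ∀ x ∈ p.support, G.Joined (P : Set E) u x := by
  induction p with
  | nil =>
    refine ⟨∅, by simp, by simp, fun x => ?_, fun x hx => ?_⟩
    · simp only [degree, SimpleGraph.Walk.support_nil, List.mem_singleton, Finset.sum_empty]
      split_ifs <;> rfl
    · rw [SimpleGraph.Walk.support_nil, List.mem_singleton] at hx
      exact hx ▸ Relation.ReflTransGen.refl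
  | @cons u w v h p ih =>
    rw [SimpleGraph.Walk.cons_isPath_iff] at hp
    obtain ⟨P, hPS, hPo, hPd, hPj⟩ := ih hp.1
    obtain ⟨e, heS, i, j, hij, hi, hj⟩ := h.2
    -- The vertex `u` is off the remaining path, so no edge of `P` meets it; hence the first edge
    -- `e` is new.
    have hdu : G.degree P u = 0 := by
      have := hPd u
      rw [if_neg hp.2] at this
      omega
    have heP : e ∉ P := by
      intro heP
      rw [degree, Finset.sum_eq_zero_iff] at hdu
      have := hdu e heP
      rw [Finset.sum_eq_zero_iff] at this
      simpa [hi] using this i (Finset.mem_univ i)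
    refine ⟨insert e P, ?_, ?_, fun x => ?_, fun x hx => ?_⟩
    · rw [Finset.coe_insert]
      exact Set.insert_subset heS hPS
    · intro f hf
      rcases Finset.mem_insert.1 hf with rfl | hf
      · exact G.not_isOuter_of_ends hij hi hj
      · exact hPo f hf
    · have h1 := hPd x
      rw [G.degree_insert heP hij hi hj, SimpleGraph.Walk.support_cons]
      by_cases hxu : x = u
      · subst hxu
        rw [if_neg hp.2] at h1
        simp only [List.mem_cons, true_or, if_true]
        omega
      · simp only [List.mem_cons, hxu, false_or, if_false]
        omega
    · rw [SimpleGraph.Walk.support_cons, List.mem_cons] at hx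
      rcases hx with rfl | hx
      · exact Relation.ReflTransGen.refl
      · refine Relation.ReflTransGen.head ⟨e, by simp, i, j, hij, hi, hj⟩ ?_
        exact Joined.mono G (by simp) (hPj x hx)

/-- An edge whose endpoints are joined in `S` lies on a circle in `S ∪ {e}`. -/
theorem exists_circle [DecidableEq E] {S : Set E} {e : E} (he : e ∉ S) {i j : Fin 2} (hij : i ≠ j)
    {u v : V} (hi : G.ends e i = some u) (hj : G.ends e j = some v) (h : G.Joined S u v) :
    ∃ P : Finset E, (P : Set E) ⊆ S ∧ G.IsCircle (insert e P) := by
  classical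
  obtain ⟨p, hp⟩ := (Joined.reachable G h).exists_isPath
  obtain ⟨P, hPS, hPo, hPd, hPj⟩ := G.exists_path_edges p hp
  have hd : ∀ x, G.degree (insert e P) x = if x ∈ p.support then 2 else 0 := fun x => by
    rw [← hPd x, ← G.degree_insert (fun h => he (hPS h)) hij hi hj x]
    congr!
  have hdj : ∀ x, G.degree (insert e P) x ≠ 0 → G.Joined (insert e P : Finset E) u x := by
    intro x hx
    have hxp : x ∈ p.support := by
      by_contra hxp
      exact hx (by rw [hd, if_neg hxp])
    exact Joined.mono G (by simp) (hPj x hxp)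
  refine ⟨P, hPS, Finset.insert_nonempty e P, ?_, fun x hx => ?_, fun x y hx hy => ?_⟩
  · intro f hf
    rcases Finset.mem_insert.1 hf with rfl | hf
    · exact G.not_isOuter_of_ends hij hi hj
    · exact hPo f hf
  · rw [hd] at hx ⊢
    split_ifs at hx ⊢ <;> simp_all
  · exact (Joined.symm G (hdj x hx)).trans (hdj y hy)

end Balance

/-! ### Chains and coboundaries -/

section Coboundary

variable (G : SignedGraph V E)

/-- The chain with prescribed values on the chosen arcs. -/
def chainOf (R : Type*) [CommRing R] (h : E → R) : G.chains R :=
  ⟨fun a => ((a.arrow 0 : ℤ) : R) * h a.edge, fun a => by simp [Arc.rev]⟩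

@[simp] theorem chainOf_arc (R : Type*) [CommRing R] (h : E → R) (e : E) :
    (G.chainOf R h).1 (G.arc e) = h e := by
  simp [chainOf, arc]

/-- The value on the chosen arc of `e` of the coboundary of the potential `p`. -/
def potentialDrop (R : Type*) [CommRing R] (p : V → R) (e : E) : R :=
  (G.ends e 0).elim 0 p - ((G.sign e : ℤ) : R) * (G.ends e 1).elim 0 p

theorem potentialDrop_eq_sum [Fintype V] (R : Type*) [CommRing R] (p : V → R) (e : E) :
    G.potentialDrop R p e = ∑ v, (G.incidence v (G.arc e) : R) * p v := by
  classical
  have h1 : ∀ i, (G.ends e i).elim 0 p = ∑ v, if G.ends e i = some v then p v else 0 := by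
    intro i
    cases h : G.ends e i with
    | none => simp
    | some w => simp
  simp only [potentialDrop, incidence, Fin.sum_univ_two, h1, arc, Finset.mul_sum,
    ← Finset.sum_sub_distrib]
  refine Finset.sum_congr rfl fun v _ => ?_
  by_cases h2 : G.ends e 0 = some v <;> by_cases h3 : G.ends e 1 = some v <;>
    simp only [h2, h3, if_true, if_false, Matrix.cons_val_zero, Matrix.cons_val_one] <;>
    push_cast <;> ring

theorem potentialDrop_intCast (R : Type*) [CommRing R] (p : V → ℤ) (e : E) :
    G.potentialDrop R (fun v => (p v : R)) e = (G.potentialDrop ℤ p e : R) := by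
  unfold potentialDrop
  cases G.ends e 0 <;> cases G.ends e 1 <;> simp

/-- The coboundary is the transpose of the boundary; flows are therefore orthogonal to coboundaries.
-/
theorem boundary_pairing [Fintype V] [Fintype E] (R : Type*) [CommRing R] (p : V → R)
    (f : G.chains R) :
    ∑ e, f.1 (G.arc e) * G.potentialDrop R p e = ∑ v, p v * G.boundary R f v := by
  simp only [G.potentialDrop_eq_sum, boundary, LinearMap.coe_mk, AddHom.coe_mk, Finset.mul_sum]
  rw [Finset.sum_comm]
  exact Finset.sum_congr rfl fun v _ => Finset.sum_congr rfl fun e _ => by ring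

theorem flow_pairing [Fintype V] [Fintype E] (R : Type*) [CommRing R] (p : V → R)
    {f : G.chains R} (hf : f ∈ G.flows R) :
    ∑ e, f.1 (G.arc e) * G.potentialDrop R p e = 0 := by
  rw [G.boundary_pairing, LinearMap.mem_ker.1 hf]
  simp

theorem boundary_intCast [Fintype E] (R : Type*) [CommRing R] (f : G.chains ℤ) (v : V) :
    G.boundary R (G.chainOf R fun e => (f.1 (G.arc e) : R)) v = (G.boundary ℤ f v : R) := by
  simp [boundary]

theorem chainOf_potentialDrop_mem_tensions [Fintype V] [Fintype E] (R : Type*) [CommRing R]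
    (p : V → R) : G.chainOf R (G.potentialDrop R p) ∈ G.tensions R := by
  intro f hf
  have hf' : G.chainOf R (fun e => (f.1 (G.arc e) : R)) ∈ G.flows R := by
    rw [flows, LinearMap.mem_ker]
    ext v
    rw [G.boundary_intCast, LinearMap.mem_ker.1 hf]
    simp
  simpa [pairing] using G.flow_pairing R p hf'

theorem support_chainOf (R : Type*) [CommRing R] (h : E → R) :
    support (G.chainOf R h) = Function.support h := by
  ext e
  simp [support]

/-- Linear maps of vector spaces have generalized inverses. -/
theorem _root_.LinearMap.exists_comp_comp_eq_self {K M N : Type*} [Field K] [AddCommGroup M]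
    [AddCommGroup N] [Module K M] [Module K N] (f : M →ₗ[K] N) :
    ∃ g : N →ₗ[K] M, f ∘ₗ g ∘ₗ f = f := by
  obtain ⟨s, hs⟩ := f.rangeRestrict.exists_rightInverse_of_surjective f.range_rangeRestrict
  obtain ⟨g, hg⟩ := LinearMap.exists_extend s
  refine ⟨g, LinearMap.ext fun x => ?_⟩
  have h1 : g (f x) = s (f.rangeRestrict x) := LinearMap.congr_fun hg (f.rangeRestrict x)
  have h2 := congrArg Subtype.val (LinearMap.congr_fun hs (f.rangeRestrict x))
  simpa [h1] using h2

/-- Every real tension is a coboundary. -/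
theorem exists_potential [Fintype V] [Fintype E] {g : G.chains ℝ} (hg : g ∈ G.tensions ℝ) :
    ∃ p : V → ℝ, ∀ e, g.1 (G.arc e) = G.potentialDrop ℝ p e := by
  classical
  -- The incidence matrix is taken over `ℚ`, so that its kernel vectors can be scaled to integer
  -- flows, the only flows a tension is tested against.
  let A : Matrix V E ℚ := fun v e => G.incidence v (G.arc e)
  obtain ⟨L, hL⟩ := (Matrix.toLin' A).exists_comp_comp_eq_self
  let B : Matrix E V ℚ := LinearMap.toMatrix' L
  have hAB : A * (B * A) = A := by
    apply Matrix.toLin'.injective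
    rw [Matrix.toLin'_mul, Matrix.toLin'_mul, Matrix.toLin'_toMatrix', hL]
  -- Each column of `D` lies in the kernel of `A`. Once `g` is seen to annihilate `D`, it follows
  -- that `g = (g * B) * A`, and `g * B` is the potential.
  let D : Matrix E E ℚ := 1 - B * A
  have hAD : A * D = 0 := by rw [Matrix.mul_sub, Matrix.mul_one, hAB, sub_self]
  have hgD : ∀ x, ∑ e, (D e x : ℝ) * g.1 (G.arc e) = 0 := by
    intro x
    -- A common denominator `N` turns column `x` of `D` into an integer flow `z`.
    obtain ⟨N, hN⟩ := IsLocalization.exist_integer_multiples_of_finite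
      (nonZeroDivisors ℤ) (fun e => D e x)
    choose z hz using hN
    have hz' : ∀ e, (z e : ℚ) = (N : ℤ) * D e x := fun e => by
      simpa using hz e
    have hN0 : ((N : ℤ) : ℚ) ≠ 0 := by exact_mod_cast nonZeroDivisors.coe_ne_zero N
    have hfl : G.chainOf ℤ z ∈ G.flows ℤ := by
      rw [flows, LinearMap.mem_ker]
      ext v
      have h1 : ∑ e, A v e * D e x = 0 := congrFun (congrFun hAD v) x
      have h2 : ((∑ e, G.incidence v (G.arc e) * z e : ℤ) : ℚ) = 0 := by
        push_cast
        simp only [hz']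
        rw [← mul_zero ((N : ℤ) : ℚ), ← h1, Finset.mul_sum]
        exact Finset.sum_congr rfl fun e _ => by simp only [A]; ring
      simpa [boundary] using (by exact_mod_cast h2 : ∑ e, G.incidence v (G.arc e) * z e = 0)
    have h3 := hg _ hfl
    simp only [pairing, chainOf_arc] at h3
    have hz'' : ∀ e, (z e : ℝ) = ((N : ℤ) : ℝ) * (D e x : ℝ) := fun e => by
      exact_mod_cast congrArg (Rat.cast : ℚ → ℝ) (hz' e)
    simp only [hz'', mul_assoc, ← Finset.mul_sum] at h3
    exact (mul_eq_zero.1 h3).resolve_left (by exact_mod_cast hN0)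
  refine ⟨fun v => ∑ e, (B e v : ℝ) * g.1 (G.arc e), fun x => ?_⟩
  have h := hgD x
  simp only [D, Matrix.sub_apply, Rat.cast_sub, sub_mul, Finset.sum_sub_distrib,
    Matrix.one_apply, Matrix.mul_apply, apply_ite (Rat.cast : ℚ → ℝ)] at h
  simp only [Rat.cast_one, Rat.cast_zero, ite_mul, one_mul, zero_mul,
    Finset.sum_ite_eq', Finset.mem_univ, if_true, Rat.cast_sum, Rat.cast_mul] at h
  rw [sub_eq_zero.1 h, G.potentialDrop_eq_sum]
  simp only [Finset.sum_mul, Finset.mul_sum, A, Rat.cast_intCast]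
  rw [Finset.sum_comm]
  exact Finset.sum_congr rfl fun v _ => Finset.sum_congr rfl fun e _ => by ring

end Coboundary

/-! ### Cuts as supports of coboundaries -/

section Cut

variable (G : SignedGraph V E)

-- Inside `X` the drop is `ν u - σ * ν v`, which vanishes iff the switched sign is 1. On a crossing
-- link or an outer-edge at `X` only one end contributes, with value ±1; elsewhere both ends
-- contribute 0.
open Classical in
theorem support_potentialDrop_eq_cutSet (X : Set V) (ν : V → ℤˣ) :
    Function.support (G.potentialDrop ℤ fun v => if v ∈ X then (ν v : ℤ) else 0) =
      G.cutSet X ν := by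
  ext e
  have hatt := G.attached e
  rw [Fin.exists_fin_two] at hatt
  simp only [Function.mem_support, cutSet, crossing, inner, outer, IsOuter, switch, potentialDrop,
    Set.mem_union, Set.mem_ofPred_eq, Fin.exists_fin_two, Fin.forall_fin_two, Fin.prod_univ_two]
  rcases Int.units_eq_one_or (G.sign e) with hs | hs <;>
  cases h0 : G.ends e 0 with
  | none =>
    cases h1 : G.ends e 1 with
    | none => simp [h0, h1] at hatt
    | some v => by_cases hv : v ∈ X <;> simp [hs, hv]
  | some u =>
    cases h1 : G.ends e 1 with
    | none => by_cases hu : u ∈ X <;> simp [hu]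
    | some v =>
      by_cases hu : u ∈ X <;> by_cases hv : v ∈ X <;>
      rcases Int.units_eq_one_or (ν u) with h2 | h2 <;>
      rcases Int.units_eq_one_or (ν v) with h3 | h3 <;>
      simp [hs, hu, hv, h2, h3]

theorem IsCut.exists_potential {U : Set E} (h : G.IsCut U) :
    ∃ p : V → ℤ, Function.support (G.potentialDrop ℤ p) = U := by
  obtain ⟨-, X, ν, -, -, rfl, -⟩ := h
  exact ⟨_, G.support_potentialDrop_eq_cutSet X ν⟩

theorem potentialDrop_eq_zero_iff {p : V → ℝ} {e : E} {i j : Fin 2} (hij : i ≠ j) {u v : V}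
    (hi : G.ends e i = some u) (hj : G.ends e j = some v) :
    G.potentialDrop ℝ p e = 0 ↔ p u = ((G.sign e : ℤ) : ℝ) * p v := by
  unfold potentialDrop
  rcases Int.units_eq_one_or (G.sign e) with hs | hs <;>
  fin_cases i <;> fin_cases j <;> simp_all <;> constructor <;> intro <;> linarith

theorem potentialDrop_ne_zero_of_ends {p : V → ℝ} {e : E} {i j : Fin 2} {u : V}
    (hi : G.ends e i = none) (hj : G.ends e j = some u) (hu : p u ≠ 0) :
    G.potentialDrop ℝ p e ≠ 0 := by
  unfold potentialDrop
  fin_cases i <;> fin_cases j <;> simp_all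

theorem exists_isCut_subset [Fintype V] (hconn : G.IsConnected)
    (hunb : ¬ G.IsBalanced Set.univ) {p : V → ℝ}
    (hp : (Function.support (G.potentialDrop ℝ p)).Nonempty) :
    ∃ U ⊆ Function.support (G.potentialDrop ℝ p), G.IsCut U := by
  classical
  obtain ⟨v₀, hv₀⟩ : ∃ v, p v ≠ 0 := by
    by_contra! h
    obtain ⟨e, he⟩ := hp
    apply he
    unfold potentialDrop
    cases G.ends e 0 <;> cases G.ends e 1 <;> simp [h]
  set Z : Set E := {e | G.potentialDrop ℝ p e = 0} with hZ
  -- The zero-drop component of `v₀`: large enough that no crossing link has zero drop, and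
  -- connected without using any edge of the cut.
  set X : Set V := {v | G.Joined Z v₀ v} with hX
  set m := |p v₀| with hm
  have hm0 : 0 < m := abs_pos.2 hv₀
  have habs : ∀ v ∈ X, |p v| = m := by
    intro v hv
    induction hv with
    | refl => rfl
    | @tail b c _ hbc ih =>
      obtain ⟨e, he, i, j, hij, hi, hj⟩ := hbc
      have h1 := (G.potentialDrop_eq_zero_iff hij hi hj).1 he
      rw [← ih, h1]
      rcases Int.units_eq_one_or (G.sign e) with hs | hs <;> simp [hs]
  -- The sign of `p` on `X`, and 1 off `X` as a switching on `X` requires.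
  set ν : V → ℤˣ := fun v => if v ∈ X ∧ p v < 0 then -1 else 1 with hν
  have hpν : ∀ v ∈ X, p v = m * ((ν v : ℤ) : ℝ) := by
    intro v hv
    rw [← habs v hv]
    by_cases h : p v < 0
    · rw [show ν v = -1 from if_pos ⟨hv, h⟩, abs_of_neg h]
      simp
    · rw [show ν v = 1 from if_neg fun h' => h h'.2, abs_of_nonneg (not_lt.1 h)]
      simp
  have hinner : ∀ e ∈ G.inner X, (G.potentialDrop ℝ p e = 0 ↔ (G.switch ν).sign e = 1) := by
    intro e he
    obtain ⟨u, hu, h0⟩ := he 0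
    obtain ⟨v, hv, h1⟩ := he 1
    rw [G.potentialDrop_eq_zero_iff (by decide) h0 h1, hpν u hu, hpν v hv]
    simp only [switch, Fin.prod_univ_two, h0, h1, Option.elim_some]
    rw [mul_left_comm, mul_right_inj' hm0.ne']
    rcases Int.units_eq_one_or (G.sign e) with hs | hs <;>
    rcases Int.units_eq_one_or (ν u) with h2 | h2 <;>
    rcases Int.units_eq_one_or (ν v) with h3 | h3 <;>
    norm_num [hs, h2, h3]
  have hsub : G.cutSet X ν ⊆ Function.support (G.potentialDrop ℝ p) := by
    rintro e ((⟨i, j, u, hu, v, hv, hi, hj⟩ | ⟨he, hs⟩) | ⟨⟨i, hi⟩, j, u, hu, hj⟩) h0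
    -- A crossing link of zero drop would extend `X`.
    · refine hv (Relation.ReflTransGen.tail hu ⟨e, h0, i, j, ?_, hi, hj⟩)
      rintro rfl
      exact hv (Option.some.inj (hi.symm.trans hj) ▸ hu)
    · rw [(hinner e he).1 h0] at hs
      exact absurd hs (by decide)
    · exact G.potentialDrop_ne_zero_of_ends hi hj (abs_pos.1 (habs u hu ▸ hm0)) h0
  have hsign : ∀ e ∈ G.inner X \ G.cutSet X ν, (G.switch ν).sign e = 1 := fun e he =>
    (Int.units_eq_one_or _).resolve_right fun h => he.2 (Or.inl (Or.inr ⟨he.1, h⟩))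
  have hnotouter : ∀ e ∈ G.inner X, ¬ G.IsOuter e := by
    rintro e he ⟨i, hi⟩
    obtain ⟨u, -, h⟩ := he i
    rw [hi] at h
    exact absurd h (by simp)
  have hsignU : ∀ e ∈ G.inner X ∩ G.cutSet X ν, (G.switch ν).sign e = -1 := fun e he =>
    (Int.units_eq_one_or _).resolve_left fun h => hsub he.2 ((hinner e he.1).2 h)
  have hv₀X : v₀ ∈ X := Relation.ReflTransGen.refl
  -- A zero-drop edge met on the way from `v₀` has both ends in `X` and, by `hsub`, is not in the
  -- cut.
  have hjoin : ∀ v ∈ X, G.Joined (G.inner X \ G.cutSet X ν) v₀ v := by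
    intro v hv
    induction hv with
    | refl => exact Relation.ReflTransGen.refl
    | @tail b c hb hbc ih =>
      refine ih.tail ?_
      have hc : c ∈ X := Relation.ReflTransGen.tail hb hbc
      obtain ⟨e, he, i, j, hij, hi, hj⟩ := hbc
      refine ⟨e, ⟨fun k => ?_, fun h => hsub h he⟩, i, j, hij, hi, hj⟩
      have hk : k = i ∨ k = j := by omega
      rcases hk with rfl | rfl
      · exact ⟨b, hb, hi⟩
      · exact ⟨c, hc, hj⟩
  refine ⟨G.cutSet X ν, hsub, ?_, X, ν, ⟨v₀, hv₀X⟩, fun v hv => if_neg fun h => hv h.1, rfl, ?_,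
    hsignU, hsign, ?_⟩
  -- If the cut set were empty, connectedness would give `X = V`, there would be no outer-edges, and
  -- `ν` would make every edge positive, contradicting unbalance.
  · by_contra hne
    rw [Set.not_nonempty_iff_eq_empty] at hne
    have hall : ∀ v, v ∈ X := by
      intro v
      have hv := hconn.2 v₀ v
      induction hv with
      | refl => exact hv₀X
      | @tail b c _ hbc ih =>
        by_contra hc
        obtain ⟨e, -, i, j, -, hi, hj⟩ := hbc
        have : e ∈ G.cutSet X ν := Or.inl (Or.inl ⟨i, j, b, ih, c, hc, hi, hj⟩)
        simp [hne] at this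
    have hout : ∀ e, ¬ G.IsOuter e := by
      intro e he
      obtain ⟨i, hi⟩ := G.attached e
      obtain ⟨u, hu⟩ := Option.ne_none_iff_exists'.1 hi
      have : e ∈ G.cutSet X ν := Or.inr ⟨he, i, u, hall u, hu⟩
      simp [hne] at this
    refine hunb (G.isBalanced_of_switch_sign (ν := ν) (fun e _ => hout e) fun e _ =>
      hsign e ⟨fun i => ?_, by simp [hne]⟩)
    obtain ⟨u, hu⟩ := Option.ne_none_iff_exists'.1 fun h => hout e ⟨i, h⟩
    exact ⟨u, hall u, hu⟩
  · exact G.isBalanced_of_switch_sign (fun e he => hnotouter e he.1) hsign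
  · intro e he hbal
    obtain ⟨u, hu, h0⟩ := he.1 0
    obtain ⟨v, hv, h1⟩ := he.1 1
    have heS : e ∉ G.inner X \ G.cutSet X ν := fun h => h.2 he.2
    -- The circle consists of `e`, negative after switching, and edges that are positive after
    -- switching; its sign is -1.
    obtain ⟨P, hPS, hC⟩ := G.exists_circle heS (by decide) h0 h1
      ((Joined.symm G (hjoin u hu)).trans (hjoin v hv))
    have h2 := hbal.2 _ (by rw [Finset.coe_insert]; exact Set.insert_subset_insert hPS) hC
    rw [← hC.prod_switch_sign G ν, Finset.prod_insert fun h => heS (hPS h), hsignU e he,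
      Finset.prod_eq_one fun f hf => hsign f (hPS hf)] at h2
    exact absurd h2 (by decide)

end Cut

/-! ### Cocircuits of the frame matroid -/

section Cocircuit

variable (G : SignedGraph V E) [Fintype E]

theorem frameMatroid_indep_iff (I : Set E) :
    G.frameMatroid.Indep I ↔ ∀ f ∈ G.flows ℝ, support f ⊆ I → f = 0 :=
  no_elementary_iff (G.flows ℝ) I

/-- A nonzero flow on `insert e I` that avoided `e` would live on the independent set `I`. -/
theorem exists_flow_of_not_indep_insert {I : Set E} {e : E} (hI : G.frameMatroid.Indep I)
    (h : ¬ G.frameMatroid.Indep (insert e I)) :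
    ∃ f ∈ G.flows ℝ, support f ⊆ insert e I ∧ f.1 (G.arc e) ≠ 0 := by
  rw [frameMatroid_indep_iff] at hI h
  push Not at h
  obtain ⟨f, hf, hfI, hf0⟩ := h
  refine ⟨f, hf, hfI, fun he => hf0 (hI f hf fun x hx => ?_)⟩
  rcases hfI hx with rfl | hxI
  · exact absurd he hx
  · exact hxI

/-- Among the edges, only `e` can carry both a nonzero flow value and a nonzero drop, so
orthogonality reduces to a single term. -/
theorem flow_pairing_eq_single [Fintype V] {f : G.chains ℝ} (hf : f ∈ G.flows ℝ) {I : Set E}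
    {e : E} (hfI : support f ⊆ insert e I) {p : V → ℝ}
    (hp : ∀ x ∈ I, x ≠ e → G.potentialDrop ℝ p x = 0) :
    f.1 (G.arc e) * G.potentialDrop ℝ p e = 0 := by
  rw [← G.flow_pairing ℝ p hf, Finset.sum_eq_single e _ (by simp)]
  intro x _ hx
  by_cases hxI : x ∈ I
  · rw [hp x hxI hx, mul_zero]
  · have : f.1 (G.arc x) = 0 := by
      by_contra h
      exact (hfI h).elim hx hxI
    rw [this, zero_mul]

/-- Independence makes the incidence column of `e` lie outside the span of the columns of `I`. A
linear functional separates it from that span, and the values of the functional on the unit vectors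
form the potential. -/
theorem exists_potential_of_indep_insert [Fintype V] {I : Set E} {e : E} (he : e ∉ I)
    (h : G.frameMatroid.Indep (insert e I)) :
    ∃ p : V → ℝ, G.potentialDrop ℝ p e ≠ 0 ∧ ∀ x ∈ I, G.potentialDrop ℝ p x = 0 := by
  classical
  let a : E → V → ℝ := fun e v => G.incidence v (G.arc e)
  have hnot : a e ∉ Submodule.span ℝ (a '' I) := by
    intro hmem
    obtain ⟨c, hc⟩ := (Fintype.mem_span_image_iff_exists_fun ℝ).1 hmem
    -- A linear relation expressing the column of `e` through `I`, read as a flow with value 1 on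
    -- `e`.
    let h' : E → ℝ := fun x => (if x = e then 1 else 0) - if hx : x ∈ I then c ⟨x, hx⟩ else 0
    have hsum : ∀ k : E → ℝ,
        ∑ x, k x * (if hx : x ∈ I then c ⟨x, hx⟩ else 0) = ∑ x : I, k x * c x := by
      intro k
      rw [← Finset.sum_filter_add_sum_filter_not Finset.univ (· ∈ I),
        Finset.sum_subtype (p := (· ∈ I)) (F := inferInstance) _ (by simp), add_eq_left.2]
      · simp
      · exact Finset.sum_eq_zero fun x hx => by simp [(Finset.mem_filter.1 hx).2]
    have h1 := (G.frameMatroid_indep_iff _).1 h (G.chainOf ℝ h') ?_ ?_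
    · have h2 : (G.chainOf ℝ h').1 (G.arc e) = 0 := by rw [h1]; rfl
      simp [h', he] at h2
    · rw [flows, LinearMap.mem_ker]
      ext v
      have h2 := congrFun hc v
      simp only [Finset.sum_apply, Pi.smul_apply, smul_eq_mul, a] at h2
      simp only [boundary, h', LinearMap.coe_mk, AddHom.coe_mk, chainOf_arc, mul_sub,
        Finset.sum_sub_distrib, hsum fun x => (G.incidence v (G.arc x) : ℝ)]
      simp [← h2, mul_comm]
    · intro x hx
      by_contra hxI
      rw [Set.mem_insert_iff, not_or] at hxI
      simp [support, h', hxI] at hx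
  obtain ⟨φ, hφe, hφI⟩ := Submodule.exists_le_ker_of_notMem hnot
  have hφ : ∀ x, G.potentialDrop ℝ (fun v => φ (Pi.single v 1)) x = φ (a x) := by
    intro x
    rw [G.potentialDrop_eq_sum, φ.pi_apply_eq_sum_univ]
    refine Finset.sum_congr rfl fun v _ => ?_
    rw [smul_eq_mul]
    congr 2
    ext w
    simp [Pi.single_apply, eq_comm]
  refine ⟨fun v => φ (Pi.single v 1), by rwa [hφ], fun x hx => ?_⟩
  rw [hφ]
  exact hφI (Submodule.subset_span ⟨x, hx, rfl⟩)

/-- Dependence of `U` in the dual means that `Uᶜ` contains no base, that is, fails to span. A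
potential whose drop vanishes on a spanning set has no drop at all, while a non-spanning set leaves
room for a nonzero one. -/
theorem frameMatroid_dual_dep_iff [Fintype V] (U : Set E) :
    G.frameMatroid.dual.Dep U ↔
      ∃ p : V → ℝ, (Function.support (G.potentialDrop ℝ p)).Nonempty ∧
        Function.support (G.potentialDrop ℝ p) ⊆ U := by
  have hE : G.frameMatroid.E = Set.univ := rfl
  rw [← Matroid.not_indep_iff (hX := Set.subset_univ U), Matroid.dual_indep_iff_exists']
  constructor
  · intro h
    obtain ⟨I, hI⟩ := G.frameMatroid.exists_isBasis Uᶜ (Set.subset_univ _)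
    obtain ⟨B, hB⟩ := G.frameMatroid.exists_isBase
    have hnb : ¬ G.frameMatroid.IsBase I := fun hIb =>
      h ⟨Set.subset_univ U, I, hIb, Set.disjoint_left.2 fun x hxU hxI => hI.subset hxI hxU⟩
    obtain ⟨e, he, hind⟩ := hI.indep.exists_insert_of_not_isBase hnb hB
    obtain ⟨p, hpe, hpI⟩ := G.exists_potential_of_indep_insert he.2 hind
    refine ⟨p, ⟨e, hpe⟩, fun x hx => ?_⟩
    by_contra hxU
    have hxI : x ∉ I := fun hxI => hx (hpI x hxI)
    -- An edge `x` of `Uᶜ` outside its basis `I` depends on `I` through a flow `f`, so a drop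
    -- vanishing on `I` vanishes at `x` too.
    obtain ⟨f, hf, hfI, hfx⟩ := G.exists_flow_of_not_indep_insert hI.indep fun hins =>
      hxI (hI.mem_of_insert_indep hxU hins)
    exact mul_ne_zero hfx hx (G.flow_pairing_eq_single hf hfI fun y hy _ => hpI y hy)
  · rintro ⟨p, ⟨e, he⟩, hpU⟩ ⟨-, B, hB, hBU⟩
    have hp : ∀ x ∈ B, G.potentialDrop ℝ p x = 0 := fun x hx => by
      by_contra hne
      exact Set.disjoint_left.1 hBU (hpU hne) hx
    have heB : e ∉ B := fun h => he (hp e h)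
    have hdep : ¬ G.frameMatroid.Indep (insert e B) := fun h =>
      heB (hB.eq_of_subset_indep h (Set.subset_insert e B) ▸ Set.mem_insert e B)
    obtain ⟨f, hf, hfB, hfe⟩ := G.exists_flow_of_not_indep_insert hB.indep hdep
    exact mul_ne_zero hfe he (G.flow_pairing_eq_single hf hfB fun x hx _ => hp x hx)

end Cocircuit

/-! ### Comparison of minimal supports -/

section Minimal

/-- A minimal `Q`-set contains a `P`-set, which is again a `Q`-set and hence equal to it. -/
theorem _root_.Set.minimal_iff_of_cofinal {α : Type*} {P Q : Set α → Prop}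
    (hPQ : ∀ s, P s → Q s) (hQP : ∀ s, Q s → ∃ t ⊆ s, P t) (U : Set α) :
    Minimal P U ↔ Minimal Q U := by
  constructor
  · refine fun h => ⟨hPQ U h.prop, fun s hs hsU => ?_⟩
    obtain ⟨t, hts, ht⟩ := hQP s hs
    exact (h.le_of_le ht (hts.trans hsU)).trans hts
  · intro h
    obtain ⟨t, htU, ht⟩ := hQP U h.prop
    obtain rfl := Set.Subset.antisymm htU (h.le_of_le (hPQ t ht) htU)
    exact ⟨ht, fun s hs hsU => h.le_of_le (hPQ s hs) hsU⟩

variable (G : SignedGraph V E)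

theorem isBond_iff_minimal (U : Set E) : G.IsBond U ↔ Minimal G.IsCut U := by
  refine and_congr_right fun _ => ⟨fun h s hs hsU => ?_, fun h s hs hsU => ?_⟩
  · by_contra hUs
    exact h s hs ⟨hsU, hUs⟩
  · exact hsU.2 (h hs hsU.1)

theorem exists_isElementary_iff_minimal {G : SignedGraph V E} {R : Type*} [CommRing R]
    (W : Submodule R (G.chains R)) (U : Set E) :
    (∃ g, IsElementary W g ∧ support g = U) ↔
      Minimal (fun S => ∃ g ∈ W, g ≠ 0 ∧ support g = S) U := by
  constructor
  · rintro ⟨g, ⟨hg, hg0, hmin⟩, rfl⟩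
    refine ⟨⟨g, hg, hg0, rfl⟩, ?_⟩
    rintro _ ⟨c, hc, hc0, rfl⟩ hle
    exact (hmin c hc hc0 hle).ge
  · rintro ⟨⟨g, hg, hg0, rfl⟩, hmin⟩
    exact ⟨g, ⟨hg, hg0, fun c hc hc0 hle => Set.Subset.antisymm hle (hmin ⟨c, hc, hc0, rfl⟩ hle)⟩,
      rfl⟩

theorem support_nonempty {G : SignedGraph V E} {R : Type*} [CommRing R] {c : G.chains R}
    (h : c ≠ 0) : (support c).Nonempty := by
  by_contra hne
  exact h (chain_ext fun e => by
    by_contra he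
    exact hne ⟨e, he⟩)

/-- The potential of a cut is integral, so one construction serves both `ℤ` and `ℝ`; the last clause
records integrality for the real case. -/
theorem IsCut.exists_tension [Fintype V] [Fintype E] (R : Type*) [CommRing R] [CharZero R]
    {U : Set E} (h : G.IsCut U) :
    ∃ g ∈ G.tensions R, g ≠ 0 ∧ support g = U ∧ ∀ a, ∃ n : ℤ, g.1 a = n := by
  obtain ⟨p, hp⟩ := IsCut.exists_potential G h
  have hs : support (G.chainOf R (G.potentialDrop R fun v => (p v : R))) = U := by
    rw [support_chainOf, ← hp]
    ext e
    simp [G.potentialDrop_intCast]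
  refine ⟨_, G.chainOf_potentialDrop_mem_tensions R _, ?_, hs, fun a => ?_⟩
  · intro h0
    obtain ⟨e, he⟩ := h.1
    rw [← hs, h0] at he
    exact he rfl
  · exact ⟨a.arrow 0 * G.potentialDrop ℤ p a.edge, by simp [chainOf, G.potentialDrop_intCast]⟩

theorem exists_isCut_subset_support [Fintype V] [Fintype E] (hconn : G.IsConnected)
    (hunb : ¬ G.IsBalanced Set.univ) {g : G.chains ℝ} (hg : g ∈ G.tensions ℝ) (h0 : g ≠ 0) :
    ∃ U ⊆ support g, G.IsCut U := by
  obtain ⟨p, hp⟩ := G.exists_potential hg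
  have hs : support g = Function.support (G.potentialDrop ℝ p) := by
    ext e
    simp [support, hp]
  have hne := support_nonempty h0
  rw [hs] at hne ⊢
  exact G.exists_isCut_subset hconn hunb hne

/-- Tensions over both rings are tested against the same integer flows, so casting to `ℝ` preserves
them. -/
theorem exists_real_tension [Fintype E] {g : G.chains ℤ} (hg : g ∈ G.tensions ℤ) (h0 : g ≠ 0) :
    ∃ g' ∈ G.tensions ℝ, g' ≠ 0 ∧ support g' = support g := by
  have hs : support (G.chainOf ℝ fun e => (g.1 (G.arc e) : ℝ)) = support g := by
    ext e
    simp [support]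
  refine ⟨_, fun f hf => ?_, fun h => ?_, hs⟩
  · have h1 := hg f hf
    simp only [pairing, chainOf_arc] at h1 ⊢
    exact_mod_cast h1
  · obtain ⟨e, he⟩ := support_nonempty h0
    rw [← hs, h] at he
    exact he rfl

end Minimal

end SignedGraph

/-! ### The three equivalences -/

theorem mainTheorem3 {V E : Type*} [Fintype V] [Fintype E] (G : SignedGraph V E)
    (hconn : G.IsConnected) (hunb : ¬ G.IsBalanced Set.univ) (U : Set E) :
    (G.IsBond U ↔
      ∃ g : G.chains ℤ, SignedGraph.IsElementary (G.tensions ℤ) g ∧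
        SignedGraph.support g = U) ∧
    (G.IsBond U ↔
      ∃ g : G.chains ℝ, SignedGraph.IsElementary (G.tensions ℝ) g ∧
        (∀ a : G.Arc, ∃ n : ℤ, g.1 a = n) ∧ SignedGraph.support g = U) ∧
    (G.IsBond U ↔ G.frameMatroid.IsCocircuit U) := by
  have hreal : G.IsBond U ↔
      ∃ g, SignedGraph.IsElementary (G.tensions ℝ) g ∧ SignedGraph.support g = U := by
    rw [G.isBond_iff_minimal, SignedGraph.exists_isElementary_iff_minimal]
    refine Set.minimal_iff_of_cofinal (fun S hS => ?_) ?_ U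
    · obtain ⟨g, hg, h0, hs, -⟩ := SignedGraph.IsCut.exists_tension G ℝ hS
      exact ⟨g, hg, h0, hs⟩
    · rintro _ ⟨g, hg, h0, rfl⟩
      exact G.exists_isCut_subset_support hconn hunb hg h0
  refine ⟨?_, ⟨fun h => ?_, fun ⟨g, hg, _, hs⟩ => hreal.2 ⟨g, hg, hs⟩⟩, ?_⟩
  · rw [G.isBond_iff_minimal, SignedGraph.exists_isElementary_iff_minimal]
    refine Set.minimal_iff_of_cofinal (fun S hS => ?_) ?_ U
    · obtain ⟨g, hg, h0, hs, -⟩ := SignedGraph.IsCut.exists_tension G ℤ hS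
      exact ⟨g, hg, h0, hs⟩
    · rintro _ ⟨g, hg, h0, rfl⟩
      obtain ⟨g', hg', h0', hs⟩ := G.exists_real_tension hg h0
      exact hs ▸ G.exists_isCut_subset_support hconn hunb hg' h0'
  · obtain ⟨g, hg, h0, hs, hint⟩ := SignedGraph.IsCut.exists_tension G ℝ h.1
    -- Being elementary depends only on the support of a nonzero tension, so the integer-valued `g`
    -- inherits it from the elementary real tension `c`.
    obtain ⟨c, hc, hcU⟩ := hreal.1 h
    refine ⟨g, ⟨hg, h0, fun c' hc' hc0' hle => ?_⟩, hint, hs⟩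
    rw [hs, ← hcU] at hle ⊢
    exact hc.2.2 c' hc' hc0' hle
  · rw [G.isBond_iff_minimal, Matroid.isCocircuit_def, Matroid.IsCircuit]
    -- Dependent sets of the dual need only contain the support of a coboundary; this suffices,
    -- since each then contains a cut.
    refine Set.minimal_iff_of_cofinal (fun S hS => ?_) (fun S hS => ?_) U
    · rw [G.frameMatroid_dual_dep_iff]
      obtain ⟨p, hp⟩ := SignedGraph.IsCut.exists_potential G hS
      have hs : Function.support (G.potentialDrop ℝ fun v => (p v : ℝ)) = S := by
        rw [← hp]
        ext e
        simp [G.potentialDrop_intCast]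
      exact ⟨fun v => p v, hs ▸ hS.1, hs.le⟩
    · obtain ⟨p, hne, hpS⟩ := (G.frameMatroid_dual_dep_iff S).1 hS
      obtain ⟨T, hT, hcut⟩ := G.exists_isCut_subset hconn hunb hne
      exact ⟨T, hT.trans hpS, hcut⟩
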